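/- Let $k\ge 3$ be an integer, let $d=2\cos(\pi/k)$, and let $\lambda_\ell=\sin(\pi\ell/k)$ for integers $\ell$. For $n\ge1$ let $TL_n(d)$ be the unital associative $\mathbb C$-algebra generated by $E_1,\dots,E_{n-1}$ subject to $E_iE_j=E_jE_i$ for $|i-j|\ge2$, $E_iE_{i\pm1}E_i=E_i$ and $E_i^2=dE_i$, and let $TL_n(d)\to TL_{n+1}(d)$ be the homomorphism with $E_i\mapsto E_i$. A *Markov trace* is a family of $\mathbb C$-linear maps $Tr_n:TL_n(d)\to\mathbb C$, $n\ge1$, such that for all $n\ge 1$: $Tr_n(1)=1$; $Tr_n(XY)=Tr_n(YX)$ for all $X,Y\in TL_n(d)$; and $Tr_{n+1}(XE_n)=\frac1d Tr_n(X)$ for all $X\in TL_n(d)$. Let $G_k$ be the graph with vertices $1,\dots,k-1$ and edges joining consecutive integers. A path of length $n$ in $G_k$ starting at $1$ is identified with a bit string of length $n$, where $0$ is a step to the left and $1$ a step to the right. Let $\mathcal H_{n,k}$ be the complex Hilbert space with an orthonormal basis $|p\rangle$ indexed by these paths, and let $\mathcal H_{n,k,\ell}$ be the subspace spanned by the $|p\rangle$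 with $p$ ending at $\ell$. For $1\le i<n$ and a path $p$, let $e$ be the vertex that $p$ reaches after its first $i-1$ steps, and write $p=a\,xy\,b$, where $x,y$ are the bits number $i$ and $i+1$. Define the operator $\Phi_i$ on $\mathcal H_{n,k}$ by $$\Phi_i|a\,00\,b\rangle=\Phi_i|a\,11\,b\rangle=0,$$ $$\Phi_i|a\,01\,b\rangle=\frac{\lambda_{e-1}}{\lambda_e}|a\,01\,b\rangle+\frac{\sqrt{\lambda_{e-1}\lambda_{e+1}}}{\lambda_e}|a\,10\,b\rangle,$$ $$\Phi_i|a\,10\,b\rangle=\frac{\sqrt{\lambda_{e-1}\lambda_{e+1}}}{\lambda_e}|a\,01\,b\rangle+\frac{\lambda_{e+1}}{\lambda_e}|a\,10\,b\rangle,$$ where a term whose bit string is not a path in $G_k$ (its coefficient is then $0$) is omitted. The operators $\Phi_i$ satisfy the defining relations of $TL_n(d)$, so that $E_i\mapsto\Phi_i$ defines a representation $\Phi:TL_n(d)\to\operatorname{End}(\mathcal H_{n,k})$. **Theorem.** A Markov trace exists, and for every $n\ge1$ the following holds. Every operator in $\operatorname{Im}\Phi$ maps each $\mathcal H_{n,k,\ell}$,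 $1\le\ell\le k-1$, into itself. For $X\in\operatorname{Im}\Phi$ let $\widetilde{Tr}_\ell(X)$ be the ordinary trace of the block of $X$ on $\mathcal H_{n,k,\ell}$, and put $$N=\sum_{\ell=1}^{k-1}\lambda_\ell\dim\mathcal H_{n,k,\ell},\qquad \widetilde{Tr}=\frac1N\sum_{\ell=1}^{k-1}\lambda_\ell\,\widetilde{Tr}_\ell:\operatorname{Im}\Phi\to\mathbb C .$$ Then $\widetilde{Tr}(XY)=\widetilde{Tr}(YX)$ for all $X,Y\in\operatorname{Im}\Phi$, and every Markov trace $(Tr_n)_{n\ge1}$ satisfies $$Tr_n=\widetilde{Tr}\circ\Phi .$$ In particular the Markov trace is unique. -/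

import Mathlib

noncomputable section

namespace PathModel

/-! ### The Temperley-Lieb algebra

The generators are indexed from `0`: the index `i : Fin (n - 1)` stands for `E_{i+1}`. -/

/-- The defining relations of the Temperley-Lieb algebra on `n` strands. -/
inductive TLRel (n : ℕ) (d : ℂ) :
    FreeAlgebra ℂ (Fin (n - 1)) → FreeAlgebra ℂ (Fin (n - 1)) → Prop
  | comm (i j : Fin (n - 1)) (h : (i : ℕ) + 2 ≤ j ∨ (j : ℕ) + 2 ≤ i) :
      TLRel n d (FreeAlgebra.ι ℂ i * FreeAlgebra.ι ℂ j)
        (FreeAlgebra.ι ℂ j * FreeAlgebra.ι ℂ i)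
  | braid (i j : Fin (n - 1)) (h : (i : ℕ) + 1 = j ∨ (j : ℕ) + 1 = i) :
      TLRel n d (FreeAlgebra.ι ℂ i * FreeAlgebra.ι ℂ j * FreeAlgebra.ι ℂ i)
        (FreeAlgebra.ι ℂ i)
  | sq (i : Fin (n - 1)) :
      TLRel n d (FreeAlgebra.ι ℂ i * FreeAlgebra.ι ℂ i) (d • FreeAlgebra.ι ℂ i)

/-- The Temperley-Lieb algebra `TL_n(d)`, by generators and relations. -/
abbrev TL (n : ℕ) (d : ℂ) : Type := RingQuot (TLRel n d)

/-- The generators of `TL_n(d)`. -/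
def TL.E (n : ℕ) (d : ℂ) (i : Fin (n - 1)) : TL n d :=
  RingQuot.mkAlgHom ℂ (TLRel n d) (FreeAlgebra.ι ℂ i)

theorem TL.E_comm (n : ℕ) (d : ℂ) (i j : Fin (n - 1))
    (h : (i : ℕ) + 2 ≤ j ∨ (j : ℕ) + 2 ≤ i) :
    TL.E n d i * TL.E n d j = TL.E n d j * TL.E n d i := by
  have := RingQuot.mkAlgHom_rel ℂ (TLRel.comm (d := d) i j h)
  simpa [TL.E] using this

theorem TL.E_braid (n : ℕ) (d : ℂ) (i j : Fin (n - 1))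
    (h : (i : ℕ) + 1 = j ∨ (j : ℕ) + 1 = i) :
    TL.E n d i * TL.E n d j * TL.E n d i = TL.E n d i := by
  have := RingQuot.mkAlgHom_rel ℂ (TLRel.braid (d := d) i j h)
  simpa [TL.E] using this

theorem TL.E_sq (n : ℕ) (d : ℂ) (i : Fin (n - 1)) :
    TL.E n d i * TL.E n d i = d • TL.E n d i := by
  have := RingQuot.mkAlgHom_rel ℂ (TLRel.sq (n := n) (d := d) i)
  simpa [TL.E] using this

/-- The universal property of `TL_n(d)`. -/
def TL.lift (n : ℕ) (d : ℂ) {A : Type} [Ring A] [Algebra ℂ A] (f : Fin (n - 1) → A)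
    (hcomm : ∀ i j : Fin (n - 1), (i : ℕ) + 2 ≤ j ∨ (j : ℕ) + 2 ≤ i → f i * f j = f j * f i)
    (hbraid : ∀ i j : Fin (n - 1), (i : ℕ) + 1 = j ∨ (j : ℕ) + 1 = i → f i * f j * f i = f i)
    (hsq : ∀ i, f i * f i = d • f i) : TL n d →ₐ[ℂ] A :=
  RingQuot.liftAlgHom ℂ ⟨FreeAlgebra.lift ℂ f, by
    intro x y h
    induction h with
    | comm i j h => simpa using hcomm i j h
    | braid i j h => simpa using hbraid i j h
    | sq i => simpa using hsq i⟩

/-- The standard homomorphism `TL_n(d) → TL_{n+1}(d)` that adds a strand, `E_i ↦ E_i`. -/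
def TL.incl (n : ℕ) (d : ℂ) : TL n d →ₐ[ℂ] TL (n + 1) d :=
  TL.lift n d (fun i => TL.E (n + 1) d ⟨i, by omega⟩)
    (fun i j h => TL.E_comm _ _ _ _ h)
    (fun i j h => TL.E_braid _ _ _ _ h)
    (fun i => TL.E_sq _ _ _)

/-- `Tr = (Tr_n)_{n ≥ 1}` is the Markov trace on the tower `TL_1(d) → TL_2(d) → ⋯`.
The last generator of `TL_{n+1}(d)`, written `E_n`, has the index `n - 1`. -/
structure IsMarkovTrace (d : ℂ) (Tr : (n : ℕ) → TL n d →ₗ[ℂ] ℂ) : Prop where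
  map_one : ∀ n, 1 ≤ n → Tr n 1 = 1
  map_mul_comm : ∀ n, 1 ≤ n → ∀ X Y : TL n d, Tr n (X * Y) = Tr n (Y * X)
  markov : ∀ (n : ℕ) (hn : 1 ≤ n) (X : TL n d),
    Tr (n + 1) (TL.incl n d X * TL.E (n + 1) d ⟨n - 1, by omega⟩) = 1 / d * Tr n X

/-! ### Paths -/

/-- `λ_ℓ = sin (π ℓ / k)`. -/
def lam (k : ℕ) (l : ℤ) : ℝ := Real.sin (Real.pi * l / k)

/-- `d = 2 cos (π / k)`. -/
def loopValue (k : ℕ) : ℂ := ((2 * Real.cos (Real.pi / k) : ℝ) : ℂ)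

/-- The position after `j` steps of the walk on `ℤ` that starts at `1` and follows the bits of
`s`, `false` (the bit `0`) being a step to the left and `true` (the bit `1`) to the right. -/
def vertex {n : ℕ} (s : Fin n → Bool) : ℕ → ℤ
  | 0 => 1
  | j + 1 => vertex s j + if h : j < n then (if s ⟨j, h⟩ then 1 else -1) else 0

/-- The walk stays in the graph `G_k`, whose vertices are `1, …, k - 1` and whose edges join
consecutive vertices. -/
def IsPath {n : ℕ} (k : ℕ) (s : Fin n → Bool) : Prop :=
  ∀ j ≤ n, 1 ≤ vertex s j ∧ vertex s j ≤ (k : ℤ) - 1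

instance {n : ℕ} (k : ℕ) : DecidablePred (IsPath (n := n) k) := fun _ =>
  inferInstanceAs (Decidable (∀ j ≤ n, _))

/-- The paths of length `n` in `G_k` that start at `1`, as bit strings. -/
abbrev Path (n k : ℕ) : Type := {s : Fin n → Bool // IsPath k s}

/-- The Hilbert space with an orthonormal basis indexed by the paths. -/
abbrev H (n k : ℕ) : Type := EuclideanSpace ℂ (Path n k)

/-- The basis vector `|s⟩` if the bit string `s` is a path, and `0` otherwise. -/
def ket {n : ℕ} (k : ℕ) (s : Fin n → Bool) : H n k :=
  if h : IsPath k s then EuclideanSpace.single ⟨s, h⟩ 1 else 0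

/-- Replace the bits number `i` and `i + 1` (counted from `0`) of `s` by `x` and `y`. -/
def setBits {n : ℕ} (s : Fin n → Bool) (i : ℕ) (x y : Bool) : Fin n → Bool :=
  fun t => if (t : ℕ) = i then x else if (t : ℕ) = i + 1 then y else s t

/-- The value at `|s⟩` of the image of the generator with index `i`; the bits number `i` and
`i + 1` of `s` are counted from `0`, and `e` is the vertex that the path reaches before them.
(Where the second bit string is not a path, its coefficient vanishes.) -/
def phiVec {n : ℕ} (k i : ℕ) (hi : i + 1 < n) (s : Fin n → Bool) : H n k :=
  let e := vertex s i
  match s ⟨i, by omega⟩, s ⟨i + 1, hi⟩ with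
  | false, false => 0
  | false, true =>
      ((lam k (e - 1) / lam k e : ℝ) : ℂ) • ket k s +
        ((√(lam k (e - 1) * lam k (e + 1)) / lam k e : ℝ) : ℂ) • ket k (setBits s i true false)
  | true, false =>
      ((√(lam k (e - 1) * lam k (e + 1)) / lam k e : ℝ) : ℂ) • ket k (setBits s i false true) +
        ((lam k (e + 1) / lam k e : ℝ) : ℂ) • ket k s
  | true, true => 0

/-- The operator `Φ_i`, given on the basis of kets. -/
def phiOp (n k : ℕ) (i : Fin (n - 1)) : Module.End ℂ (H n k) :=
  (EuclideanSpace.basisFun (Path n k) ℂ).toBasis.constr ℂ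
    (fun p => phiVec k i (by omega) p.1)

/-! ### The operators satisfy the Temperley-Lieb relations -/

section Relations

variable {n k : ℕ}

theorem ket_of_isPath {s : Fin n → Bool} (h : IsPath k s) :
    ket k s = EuclideanSpace.single ⟨s, h⟩ 1 := dif_pos h

theorem ket_of_not {s : Fin n → Bool} (h : ¬ IsPath k s) : ket k s = 0 := dif_neg h

theorem end_ext {f g : Module.End ℂ (H n k)}
    (h : ∀ s : Fin n → Bool, IsPath k s → f (ket k s) = g (ket k s)) : f = g := by
  apply (EuclideanSpace.basisFun (Path n k) ℂ).toBasis.ext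
  intro p
  have := h p.1 p.2
  rw [ket_of_isPath p.2] at this
  simpa using this

theorem lam_zero (k : ℕ) : lam k 0 = 0 := by simp [lam]

theorem lam_self (k : ℕ) : lam k k = 0 := by
  unfold lam
  rcases Nat.eq_zero_or_pos k with rfl | h
  · simp
  · have : (k : ℝ) ≠ 0 := by positivity
    rw [show Real.pi * ((k : ℤ) : ℝ) / k = Real.pi by push_cast; field_simp]
    exact Real.sin_pi

theorem lam_pos {l : ℤ} (h1 : 1 ≤ l) (h2 : l ≤ (k : ℤ) - 1) : 0 < lam k l := by
  have hl : (1 : ℝ) ≤ l := by exact_mod_cast h1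
  have hk : (l : ℝ) + 1 ≤ k := by
    have : l + 1 ≤ (k : ℤ) := by omega
    exact_mod_cast this
  have hk0 : (0 : ℝ) < k := by linarith
  apply Real.sin_pos_of_pos_of_lt_pi
  · have := Real.pi_pos
    positivity
  · rw [div_lt_iff₀ hk0]
    have := Real.pi_pos
    nlinarith

theorem lam_nonneg {l : ℤ} (h1 : 0 ≤ l) (h2 : l ≤ (k : ℤ)) : 0 ≤ lam k l := by
  rcases eq_or_lt_of_le h1 with h | h
  · rw [← h, lam_zero]
  rcases eq_or_lt_of_le h2 with h' | h'
  · rw [h', lam_self]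
  · exact (lam_pos (by omega) (by omega)).le

theorem lam_add (k : ℕ) (l : ℤ) :
    lam k (l - 1) + lam k (l + 1) = 2 * Real.cos (Real.pi / k) * lam k l := by
  unfold lam
  have h1 : Real.pi * ((l - 1 : ℤ) : ℝ) / k = Real.pi * l / k - Real.pi / k := by
    push_cast; ring
  have h2 : Real.pi * ((l + 1 : ℤ) : ℝ) / k = Real.pi * l / k + Real.pi / k := by
    push_cast; ring
  rw [h1, h2, Real.sin_sub, Real.sin_add]
  ring

theorem vertex_succ (s : Fin n → Bool) {j : ℕ} (h : j < n) :
    vertex s (j + 1) = vertex s j + if s ⟨j, h⟩ then 1 else -1 := by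
  simp [vertex, h]

theorem vertex_congr {s t : Fin n → Bool} (j : ℕ)
    (h : ∀ a : Fin n, (a : ℕ) < j → s a = t a) : vertex s j = vertex t j := by
  induction j with
  | zero => rfl
  | succ j ih =>
    rw [vertex, vertex, ih (fun a ha => h a (by omega))]
    by_cases hj : j < n
    · simp [hj, h ⟨j, hj⟩ (by simp)]
    · simp [hj]

theorem vertex_setBits_le (s : Fin n → Bool) (x y : Bool) {i j : ℕ} (h : j ≤ i) :
    vertex (setBits s i x y) j = vertex s j := by
  apply vertex_congr
  intro a ha
  simp [setBits, show (a : ℕ) ≠ i by omega, show (a : ℕ) ≠ i + 1 by omega]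

theorem setBits_fst (s : Fin n → Bool) (x y : Bool) {i : ℕ} (h : i < n) :
    setBits s i x y ⟨i, h⟩ = x := by simp [setBits]

theorem setBits_snd (s : Fin n → Bool) (x y : Bool) {i : ℕ} (h : i + 1 < n) :
    setBits s i x y ⟨i + 1, h⟩ = y := by simp [setBits]

theorem setBits_ne (s : Fin n → Bool) (x y : Bool) {i j : ℕ} (h : j < n) (h1 : j ≠ i)
    (h2 : j ≠ i + 1) : setBits s i x y ⟨j, h⟩ = s ⟨j, h⟩ := by simp [setBits, h1, h2]

theorem setBits_setBits (s : Fin n → Bool) (x y x' y' : Bool) (i : ℕ) :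
    setBits (setBits s i x y) i x' y' = setBits s i x' y' := by
  funext t
  simp only [setBits]
  split_ifs <;> rfl

theorem setBits_self (s : Fin n → Bool) {x y : Bool} {i : ℕ} (h : i + 1 < n)
    (hx : s ⟨i, by omega⟩ = x) (hy : s ⟨i + 1, h⟩ = y) : setBits s i x y = s := by
  funext t
  simp only [setBits]
  split_ifs with h1 h2
  · rw [← hx]; congr 1; exact Fin.ext h1.symm
  · rw [← hy]; congr 1; exact Fin.ext h2.symm
  · rfl

theorem setBits_comm (s : Fin n → Bool) (x y x' y' : Bool) {i j : ℕ} (h : i + 2 ≤ j) :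
    setBits (setBits s i x y) j x' y' = setBits (setBits s j x' y') i x y := by
  funext t
  simp only [setBits]
  split_ifs <;> first | rfl | omega

/-- Exchanging the two different bits `i`, `i + 1` changes only the vertex number `i + 1`. -/
theorem vertex_setBits_ge (s : Fin n → Bool) {x y : Bool} {i j : ℕ} (hi : i + 1 < n)
    (hx : s ⟨i, by omega⟩ = x) (hy : s ⟨i + 1, hi⟩ = y) (h : i + 2 ≤ j) :
    vertex (setBits s i y x) j = vertex s j := by
  obtain ⟨m, rfl⟩ := Nat.exists_eq_add_of_le h
  induction m with
  | zero =>
    simp only [Nat.add_zero]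
    rw [vertex_succ _ hi, vertex_succ _ (show i < n by omega), vertex_succ _ hi,
      vertex_succ _ (show i < n by omega), setBits_fst, setBits_snd, hx, hy,
      vertex_setBits_le _ _ _ le_rfl]
    ring
  | succ m ih =>
    rw [← Nat.add_assoc, vertex, vertex, ih (by omega)]
    by_cases hj : i + 2 + m < n
    · simp only [hj, dif_pos]
      rw [setBits_ne _ _ _ _ (by omega) (by omega)]
    · simp [hj]

theorem not_isPath_of_flip {s : Fin n → Bool} {x y : Bool} {i : ℕ} (hi : i + 1 < n)
    (hx : s ⟨i, by omega⟩ = x) (hy : s ⟨i + 1, hi⟩ = y)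
    (hs : ¬ IsPath k s) (hs' : IsPath k (setBits s i y x)) :
    vertex s (i + 1) < 1 ∨ (k : ℤ) - 1 < vertex s (i + 1) := by
  by_contra! hc
  apply hs
  intro j hj
  rcases lt_trichotomy j (i + 1) with h | h | h
  · have := hs' j hj
    rwa [vertex_setBits_le _ _ _ (by omega)] at this
  · subst h; exact hc
  · have := hs' j hj
    rwa [vertex_setBits_ge s hi hx hy (by omega)] at this

theorem phiVec_00 {i : ℕ} (hi : i + 1 < n) {s : Fin n → Bool} {x : Bool}
    (hx : s ⟨i, by omega⟩ = x) (hy : s ⟨i + 1, hi⟩ = x) : phiVec k i hi s = 0 := by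
  cases x <;> simp [phiVec, hx, hy]

theorem phiVec_01 {i : ℕ} (hi : i + 1 < n) {s : Fin n → Bool}
    (hx : s ⟨i, by omega⟩ = false) (hy : s ⟨i + 1, hi⟩ = true) :
    phiVec k i hi s =
      ((lam k (vertex s i - 1) / lam k (vertex s i) : ℝ) : ℂ) • ket k s +
        ((√(lam k (vertex s i - 1) * lam k (vertex s i + 1)) / lam k (vertex s i) : ℝ) : ℂ) •
          ket k (setBits s i true false) := by
  simp [phiVec, hx, hy]

theorem phiVec_10 {i : ℕ} (hi : i + 1 < n) {s : Fin n → Bool}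
    (hx : s ⟨i, by omega⟩ = true) (hy : s ⟨i + 1, hi⟩ = false) :
    phiVec k i hi s =
      ((lam k (vertex s i + 1) / lam k (vertex s i) : ℝ) : ℂ) • ket k s +
        ((√(lam k (vertex s i - 1) * lam k (vertex s i + 1)) / lam k (vertex s i) : ℝ) : ℂ) •
          ket k (setBits s i false true) := by
  simp [phiVec, hx, hy, add_comm]

/-- The formula for `Φ_i` holds on all bit strings. -/
theorem phiOp_ket (i : Fin (n - 1)) (s : Fin n → Bool) :
    phiOp n k i (ket k s) = phiVec k i (by omega) s := by
  have hi : (i : ℕ) + 1 < n := by omega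
  by_cases h : IsPath k s
  · have h2 : ket k s = (EuclideanSpace.basisFun (Path n k) ℂ).toBasis ⟨s, h⟩ := by
      rw [ket_of_isPath h]; simp
    rw [h2, phiOp, Module.Basis.constr_basis]
  · rw [ket_of_not h, map_zero]
    symm
    by_cases hxy : s ⟨i, by omega⟩ = s ⟨i + 1, hi⟩
    · exact phiVec_00 hi hxy rfl
    cases hx : s ⟨i, by omega⟩ <;> cases hy : s ⟨i + 1, hi⟩
    · simp_all
    · rw [phiVec_01 hi hx hy, ket_of_not h, smul_zero, zero_add]
      by_cases h' : IsPath k (setBits s i true false)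
      · have := not_isPath_of_flip hi hx hy h h'
        have hv := h' i (by omega)
        rw [vertex_setBits_le _ _ _ le_rfl] at hv
        rw [vertex_succ s (show (i : ℕ) < n by omega), hx] at this
        have h1 : vertex s i - 1 = 0 := by
          simp at this; omega
        simp [h1, lam_zero]
      · rw [ket_of_not h', smul_zero]
    · rw [phiVec_10 hi hx hy, ket_of_not h, smul_zero, zero_add]
      by_cases h' : IsPath k (setBits s i false true)
      · have := not_isPath_of_flip hi hx hy h h'
        have hv := h' i (by omega)
        rw [vertex_setBits_le _ _ _ le_rfl] at hv
        rw [vertex_succ s (show (i : ℕ) < n by omega), hx] at this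
        have h1 : vertex s i + 1 = k := by
          simp at this; omega
        simp [h1, lam_self]
      · rw [ket_of_not h', smul_zero]
    · simp_all

theorem vertex_succ_of {s : Fin n → Bool} {j : ℕ} {x : Bool} (h : j < n) (hx : s ⟨j, h⟩ = x) :
    vertex s (j + 1) = vertex s j + if x then 1 else -1 := by
  rw [vertex_succ s h, hx]

theorem phiOp_eq_zero (i : Fin (n - 1)) {s : Fin n → Bool} {x : Bool}
    (hx : s ⟨i, by omega⟩ = x) (hy : s ⟨i + 1, by omega⟩ = x) :
    phiOp n k i (ket k s) = 0 := by
  rw [phiOp_ket, phiVec_00 _ hx hy]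

theorem phiOp_ne (i : Fin (n - 1)) {s : Fin n → Bool} {x : Bool}
    (hx : s ⟨i, by omega⟩ = x) (hy : s ⟨i + 1, by omega⟩ = !x) {e o : ℤ}
    (he : vertex s i = e) (ho : (if x then 1 else -1) = o) :
    phiOp n k i (ket k s) =
      ((lam k (e + o) / lam k e : ℝ) : ℂ) • ket k s +
        ((√(lam k (e + o) * lam k (e - o)) / lam k e : ℝ) : ℂ) •
          ket k (setBits s i (!x) x) := by
  subst he
  subst ho
  rw [phiOp_ket]
  cases x
  · rw [phiVec_01 _ hx hy]
    simp [sub_eq_add_neg]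
  · rw [phiVec_10 _ hx hy]
    simp [mul_comm]

theorem sq_aux {V : Type} [AddCommGroup V] [Module ℂ V] (f : Module.End ℂ V) {u v : V}
    {a b c d : ℂ} (hu : f u = a • u + b • v) (hv : f v = c • v + b • u)
    (h1 : a * a + b * b = d * a) (h2 : a * b + b * c = d * b) :
    f (f u) = d • f u := by
  rw [hu, map_add, map_smul, map_smul, hu, hv]
  match_scalars
  · linear_combination h1
  · linear_combination h2

theorem braid_aux1 {V : Type} [AddCommGroup V] [Module ℂ V] (f g : Module.End ℂ V) {u v r : V}
    {a b m B : ℂ} (hu : f u = a • u + b • v) (hgu : g u = m • u + B • r) (hgv : g v = 0)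
    (hr : f r = 0) (h : a * m = 1) : f (g (f u)) = f u := by
  conv_lhs => rw [hu]
  rw [map_add, map_smul, map_smul, hgv, hgu, smul_zero, add_zero, map_smul, map_add, map_smul,
    map_smul, hr, smul_zero, add_zero, smul_smul, h, one_smul]

theorem braid_aux2 {V : Type} [AddCommGroup V] [Module ℂ V] (f g : Module.End ℂ V) {u v r : V}
    {a b c m B : ℂ} (hu : f u = a • u + b • v) (hv : f v = c • v + b • u) (hgu : g u = 0)
    (hgv : g v = m • v + B • r) (hr : f r = 0) (h1 : b * m * b = a) (h2 : b * m * c = b) :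
    f (g (f u)) = f u := by
  rw [hu, map_add, map_smul, map_smul, hgu, hgv, smul_zero, zero_add, map_smul, map_add, map_smul,
    map_smul, hr, hv]
  match_scalars
  · linear_combination h2
  · linear_combination h1

theorem lam_prod_nonneg {e o : ℤ} (h1 : 1 ≤ e) (h2 : e ≤ (k : ℤ) - 1) (ho : o = 1 ∨ o = -1) :
    0 ≤ lam k (e + o) * lam k (e - o) := by
  apply mul_nonneg <;> apply lam_nonneg <;> rcases ho with rfl | rfl <;> omega

theorem sgn_cases (x : Bool) : (if x then (1 : ℤ) else -1) = 1 ∨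
    (if x then (1 : ℤ) else -1) = -1 := by cases x <;> simp

theorem lam_add' (k : ℕ) (e : ℤ) {o : ℤ} (ho : o = 1 ∨ o = -1) :
    lam k (e + o) + lam k (e - o) = 2 * Real.cos (Real.pi / k) * lam k e := by
  rw [← lam_add]
  rcases ho with rfl | rfl
  · ring
  · rw [sub_neg_eq_add, sub_eq_add_neg]

/-- `Φ_i` at the bit string obtained by exchanging the bits `i`, `i + 1`. -/
theorem phiOp_flip (i : Fin (n - 1)) {s : Fin n → Bool} {x : Bool}
    (hx : s ⟨i, by omega⟩ = x) (hy : s ⟨i + 1, by omega⟩ = !x) {e o : ℤ}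
    (he : vertex s i = e) (ho : (if x then 1 else -1) = o) :
    phiOp n k i (ket k (setBits s i (!x) x)) =
      ((lam k (e - o) / lam k e : ℝ) : ℂ) • ket k (setBits s i (!x) x) +
        ((√(lam k (e + o) * lam k (e - o)) / lam k e : ℝ) : ℂ) • ket k s := by
  have hi : (i : ℕ) < n := by omega
  have hi' : (i : ℕ) + 1 < n := by omega
  rw [phiOp_ne i (s := setBits s i (!x) x) (x := !x) (e := e) (o := -o)
    (setBits_fst _ _ _ hi) (by simp [setBits_snd _ _ _ hi'])
    (by rw [vertex_setBits_le _ _ _ le_rfl, he]) (by subst ho; cases x <;> simp),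
    setBits_setBits, setBits_self s hi' (by simpa using hx) hy]
  simp [sub_eq_add_neg, mul_comm]

theorem phiOp_sq (i : Fin (n - 1)) :
    phiOp n k i * phiOp n k i = loopValue k • phiOp n k i := by
  apply end_ext
  intro s hs
  simp only [Module.End.mul_apply, LinearMap.smul_apply]
  have hi : (i : ℕ) < n := by omega
  have hi' : (i : ℕ) + 1 < n := by omega
  obtain ⟨x, hx⟩ : ∃ x, s ⟨i, hi⟩ = x := ⟨_, rfl⟩
  by_cases hy : s ⟨i + 1, hi'⟩ = x
  · rw [phiOp_eq_zero i hx hy]; simp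
  have hy : s ⟨i + 1, hi'⟩ = !x := by revert hy; cases x <;> simp
  obtain ⟨he1, he2⟩ := hs i hi.le
  have hE := (lam_pos he1 he2).ne'
  obtain ⟨o, ho⟩ : ∃ o : ℤ, (if x then 1 else -1) = o := ⟨_, rfl⟩
  have ho1 : o = 1 ∨ o = -1 := ho ▸ sgn_cases x
  have ha := lam_add' k (vertex s i) ho1
  have hsq := Real.mul_self_sqrt (lam_prod_nonneg he1 he2 ho1)
  refine sq_aux _ (phiOp_ne i hx hy rfl ho) (phiOp_flip i hx hy rfl ho) ?_ ?_
  · unfold loopValue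
    norm_cast
    field_simp
    linear_combination hsq + lam k (vertex s i + o) * ha
  · unfold loopValue
    norm_cast
    field_simp
    linear_combination √(lam k (vertex s i + o) * lam k (vertex s i - o)) * ha

theorem phiOp_braid_up (i j : Fin (n - 1)) (hij : (i : ℕ) + 1 = j) :
    phiOp n k i * phiOp n k j * phiOp n k i = phiOp n k i := by
  apply end_ext
  intro s hs
  simp only [Module.End.mul_apply]
  obtain ⟨i, hi0⟩ := i
  obtain ⟨j, hj0⟩ := j
  simp only at hij
  subst hij
  have hi : i < n := by omega
  have hi' : i + 1 < n := by omega
  have hi'' : i + 1 + 1 < n := by omega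
  obtain ⟨x, hx⟩ : ∃ x, s ⟨i, hi⟩ = x := ⟨_, rfl⟩
  by_cases hy : s ⟨i + 1, hi'⟩ = x
  · rw [phiOp_eq_zero ⟨i, hi0⟩ hx hy]; simp
  have hy : s ⟨i + 1, hi'⟩ = !x := by revert hy; cases x <;> simp
  obtain ⟨o, ho⟩ : ∃ o : ℤ, (if x then 1 else -1) = o := ⟨_, rfl⟩
  have ho1 : o = 1 ∨ o = -1 := ho ▸ sgn_cases x
  have ho' : (if !x then (1 : ℤ) else -1) = -o := by subst ho; cases x <;> simp
  obtain ⟨e, he⟩ : ∃ e, vertex s i = e := ⟨_, rfl⟩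
  have hv1 : vertex s (i + 1) = e + o := by rw [vertex_succ_of hi hx, he, ho]
  have hv2 : vertex s (i + 1 + 1) = e := by rw [vertex_succ_of hi' hy, hv1, ho']; ring
  obtain ⟨he1, he2⟩ := hs i hi.le
  obtain ⟨hf1, hf2⟩ := hs (i + 1) hi'.le
  rw [he] at he1 he2
  rw [hv1] at hf1 hf2
  have hE := (lam_pos he1 he2).ne'
  have hF := (lam_pos hf1 hf2).ne'
  have hsq := Real.mul_self_sqrt (lam_prod_nonneg he1 he2 ho1)
  by_cases hz : s ⟨i + 1 + 1, hi''⟩ = x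
  · refine braid_aux1 _ _ (phiOp_ne ⟨i, hi0⟩ hx hy he ho)
      (phiOp_ne ⟨i + 1, hj0⟩ hy (by simpa using hz) hv1 ho') ?_ ?_ ?_
    · exact phiOp_eq_zero ⟨i + 1, hj0⟩ (x := x) (setBits_snd _ _ _ hi')
        (by rw [setBits_ne _ _ _ _ (by simp; omega) (by simp)]; exact hz)
    · exact phiOp_eq_zero ⟨i, hi0⟩ (x := x)
        (by rw [setBits_ne _ _ _ _ (by simp) (by simp; omega)]; exact hx)
        (by simp [setBits_fst _ _ _ hi'])
    · norm_cast
      rw [show e + o + -o = e by ring]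
      field_simp
  · have hz : s ⟨i + 1 + 1, hi''⟩ = !x := by revert hz; cases x <;> simp
    have hv3 : vertex s (i + 1 + 1 + 1) = e - o := by
      rw [vertex_succ_of hi'' hz, hv2, ho']; ring
    obtain ⟨hg1, hg2⟩ := hs (i + 1 + 1 + 1) (by omega)
    rw [hv3] at hg1 hg2
    have hG := (lam_pos hg1 hg2).ne'
    have htv : vertex (setBits s i (!x) x) (i + 1) = e - o := by
      rw [vertex_succ_of hi (setBits_fst _ _ _ hi), vertex_setBits_le _ _ _ le_rfl, he, ho']
      ring
    refine braid_aux2 _ _ (phiOp_ne ⟨i, hi0⟩ hx hy he ho) (phiOp_flip ⟨i, hi0⟩ hx hy he ho)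
      (phiOp_eq_zero ⟨i + 1, hj0⟩ hy hz)
      (phiOp_ne ⟨i + 1, hj0⟩ (setBits_snd _ _ _ hi')
        (by rw [setBits_ne _ _ _ _ (by simp; omega) (by simp)]; exact hz) htv ho) ?_ ?_ ?_
    · exact phiOp_eq_zero ⟨i, hi0⟩ (x := !x)
        (by rw [setBits_ne _ _ _ _ (by simp) (by simp; omega)]; exact setBits_fst _ _ _ hi)
        (setBits_fst _ _ _ hi')
    · norm_cast
      rw [show e - o + o = e by ring]
      field_simp
      linear_combination hsq
    · norm_cast
      rw [show e - o + o = e by ring]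
      field_simp

theorem phiOp_braid_down (i j : Fin (n - 1)) (hij : (j : ℕ) + 1 = i) :
    phiOp n k i * phiOp n k j * phiOp n k i = phiOp n k i := by
  apply end_ext
  intro s hs
  simp only [Module.End.mul_apply]
  obtain ⟨i, hi0⟩ := i
  obtain ⟨j, hj0⟩ := j
  simp only at hij
  subst hij
  have hj : j < n := by omega
  have hj' : j + 1 < n := by omega
  have hj'' : j + 1 + 1 < n := by omega
  obtain ⟨y, hy⟩ : ∃ y, s ⟨j + 1, hj'⟩ = y := ⟨_, rfl⟩
  by_cases hz : s ⟨j + 1 + 1, hj''⟩ = y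
  · rw [phiOp_eq_zero ⟨j + 1, hi0⟩ hy hz]; simp
  have hz : s ⟨j + 1 + 1, hj''⟩ = !y := by revert hz; cases y <;> simp
  obtain ⟨o, ho⟩ : ∃ o : ℤ, (if y then 1 else -1) = o := ⟨_, rfl⟩
  have ho1 : o = 1 ∨ o = -1 := ho ▸ sgn_cases y
  have ho' : (if !y then (1 : ℤ) else -1) = -o := by subst ho; cases y <;> simp
  obtain ⟨e, he⟩ : ∃ e, vertex s (j + 1) = e := ⟨_, rfl⟩
  have hv2 : vertex s (j + 1 + 1) = e + o := by rw [vertex_succ_of hj' hy, he, ho]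
  obtain ⟨he1, he2⟩ := hs (j + 1) hj'.le
  obtain ⟨hf1, hf2⟩ := hs (j + 1 + 1) hj''.le
  obtain ⟨hg1, hg2⟩ := hs j hj.le
  rw [he] at he1 he2
  rw [hv2] at hf1 hf2
  have hE := (lam_pos he1 he2).ne'
  have hF := (lam_pos hf1 hf2).ne'
  have hG := (lam_pos hg1 hg2).ne'
  have hsq := Real.mul_self_sqrt (lam_prod_nonneg he1 he2 ho1)
  by_cases hx : s ⟨j, hj⟩ = y
  · have hv0 : vertex s j = e - o := by
      have := vertex_succ_of hj hx
      rw [he, ho] at this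
      omega
    rw [hv0] at hG
    refine braid_aux2 _ _ (phiOp_ne ⟨j + 1, hi0⟩ hy hz he ho)
      (phiOp_flip ⟨j + 1, hi0⟩ hy hz he ho) (phiOp_eq_zero ⟨j, hj0⟩ hx hy)
      (phiOp_ne ⟨j, hj0⟩ (by rw [setBits_ne _ _ _ _ (by simp) (by simp; omega)]; exact hx)
        (setBits_fst _ _ _ hj')
        (by rw [vertex_setBits_le _ _ _ (by simp), hv0]) ho) ?_ ?_ ?_
    · exact phiOp_eq_zero ⟨j + 1, hi0⟩ (x := y) (setBits_snd _ _ _ hj')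
        (by
          rw [setBits_ne _ _ _ _ (by simp; omega) (by simp)]
          exact setBits_snd _ _ _ hj'')
    · norm_cast
      rw [show e - o + o = e by ring]
      field_simp
      linear_combination hsq
    · norm_cast
      rw [show e - o + o = e by ring]
      field_simp
  · have hx : s ⟨j, hj⟩ = !y := by revert hx; cases y <;> simp
    have hv0 : vertex s j = e + o := by
      have := vertex_succ_of hj hx
      rw [he, ho'] at this
      omega
    rw [hv0] at hG
    refine braid_aux1 _ _ (phiOp_ne ⟨j + 1, hi0⟩ hy hz he ho)
      (phiOp_ne ⟨j, hj0⟩ hx (by simpa using hy) hv0 ho') ?_ ?_ ?_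
    · exact phiOp_eq_zero ⟨j, hj0⟩ (x := !y)
        (by rw [setBits_ne _ _ _ _ (by simp) (by simp; omega)]; exact hx)
        (setBits_fst _ _ _ hj')
    · exact phiOp_eq_zero ⟨j + 1, hi0⟩ (x := !y) (setBits_snd _ _ _ hj')
        (by
          rw [setBits_ne _ _ _ _ (by simp; omega) (by simp)]
          exact hz)
    · norm_cast
      rw [show e + o + -o = e by ring]
      field_simp

theorem phiOp_comm_aux (i j : Fin (n - 1)) (hij : (i : ℕ) + 2 ≤ j) :
    phiOp n k i * phiOp n k j = phiOp n k j * phiOp n k i := by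
  apply end_ext
  intro s hs
  simp only [Module.End.mul_apply]
  have hi : (i : ℕ) < n := by omega
  have hi' : (i : ℕ) + 1 < n := by omega
  have hj : (j : ℕ) < n := by omega
  have hj' : (j : ℕ) + 1 < n := by omega
  obtain ⟨x, hx⟩ : ∃ x, s ⟨i, hi⟩ = x := ⟨_, rfl⟩
  obtain ⟨y, hy⟩ : ∃ y, s ⟨j, hj⟩ = y := ⟨_, rfl⟩
  -- exchanging bits at one place does not change the bits at the other
  have hi1 (a b : Bool) : setBits s j a b ⟨i, hi⟩ = x := by
    rw [setBits_ne _ _ _ _ (by omega) (by omega), hx]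
  have hi2 (a b : Bool) : setBits s j a b ⟨i + 1, hi'⟩ = s ⟨i + 1, hi'⟩ :=
    setBits_ne _ _ _ _ (by omega) (by omega)
  have hj1 (a b : Bool) : setBits s i a b ⟨j, hj⟩ = y := by
    rw [setBits_ne _ _ _ _ (by omega) (by omega), hy]
  have hj2 (a b : Bool) : setBits s i a b ⟨j + 1, hj'⟩ = s ⟨j + 1, hj'⟩ :=
    setBits_ne _ _ _ _ (by omega) (by omega)
  by_cases hx' : s ⟨i + 1, hi'⟩ = x
  · rw [phiOp_eq_zero i hx hx', map_zero]
    by_cases hy' : s ⟨j + 1, hj'⟩ = y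
    · rw [phiOp_eq_zero j hy hy', map_zero]
    have hy' : s ⟨j + 1, hj'⟩ = !y := by revert hy'; cases y <;> simp
    rw [phiOp_ne j hy hy' rfl rfl, map_add, map_smul, map_smul, phiOp_eq_zero i hx hx',
      phiOp_eq_zero i (hi1 _ _) ((hi2 _ _).trans hx')]
    simp
  have hx' : s ⟨i + 1, hi'⟩ = !x := by revert hx'; cases x <;> simp
  by_cases hy' : s ⟨j + 1, hj'⟩ = y
  · rw [phiOp_eq_zero j hy hy', map_zero, phiOp_ne i hx hx' rfl rfl, map_add, map_smul, map_smul,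
      phiOp_eq_zero j hy hy', phiOp_eq_zero j (hj1 _ _) ((hj2 _ _).trans hy')]
    simp
  have hy' : s ⟨j + 1, hj'⟩ = !y := by revert hy'; cases y <;> simp
  rw [phiOp_ne j hy hy' rfl rfl, phiOp_ne i hx hx' rfl rfl, map_add, map_smul, map_smul,
    map_add, map_smul, map_smul, phiOp_ne j hy hy' rfl rfl, phiOp_ne i hx hx' rfl rfl,
    phiOp_ne i (hi1 _ _) ((hi2 _ _).trans hx') (vertex_setBits_le _ _ _ (by omega)) rfl,
    phiOp_ne j (hj1 _ _) ((hj2 _ _).trans hy') (vertex_setBits_ge s hi' hx hx' hij) rfl,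
    setBits_comm s _ _ _ _ hij]
  module

theorem phiOp_comm (i j : Fin (n - 1)) (hij : (i : ℕ) + 2 ≤ j ∨ (j : ℕ) + 2 ≤ i) :
    phiOp n k i * phiOp n k j = phiOp n k j * phiOp n k i := by
  rcases hij with h | h
  · exact phiOp_comm_aux i j h
  · exact (phiOp_comm_aux j i h).symm

theorem phiOp_braid (i j : Fin (n - 1)) (hij : (i : ℕ) + 1 = j ∨ (j : ℕ) + 1 = i) :
    phiOp n k i * phiOp n k j * phiOp n k i = phiOp n k i := by
  rcases hij with h | h
  · exact phiOp_braid_up i j h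
  · exact phiOp_braid_down i j h

end Relations

/-- The path-model representation `Φ` of `TL_n(d)`, `d = 2 cos (π / k)`, on `H n k`. -/
def Phi (n k : ℕ) : TL n (loopValue k) →ₐ[ℂ] Module.End ℂ (H n k) :=
  TL.lift n (loopValue k) (phiOp n k) phiOp_comm phiOp_braid phiOp_sq

/-! ### The weighted trace -/

/-- The subspace `H_{n,k,ℓ}` spanned by the kets of the paths that end at the vertex `ℓ`. -/
def Hend (n k : ℕ) (l : ℤ) : Submodule ℂ (H n k) :=
  Submodule.span ℂ (ket k '' {s : Fin n → Bool | IsPath k s ∧ vertex s n = l})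

/-- The block of `X` on `H_{n,k,ℓ}`: the restriction of `X` to this subspace, followed by the
orthogonal projection onto it. -/
def block (n k : ℕ) (l : ℤ) (X : Module.End ℂ (H n k)) : Module.End ℂ (Hend n k l) :=
  (Hend n k l).orthogonalProjectionOnto.toLinearMap ∘ₗ X ∘ₗ (Hend n k l).subtype

/-- The standard trace of the block on `H_{n,k,ℓ}`, as a linear functional. -/
def trEnd (n k : ℕ) (l : ℤ) : Module.End ℂ (H n k) →ₗ[ℂ] ℂ where
  toFun X := LinearMap.trace ℂ (Hend n k l) (block n k l X)
  map_add' X Y := by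
    rw [← map_add]; congr 1; ext v; simp [block]
  map_smul' c X := by
    rw [RingHom.id_apply, ← map_smul]; congr 1; ext v; simp [block]

/-- `N = ∑_{ℓ=1}^{k-1} λ_ℓ dim H_{n,k,ℓ}`. -/
def normalization (n k : ℕ) : ℝ :=
  ∑ l ∈ Finset.Icc (1 : ℤ) ((k : ℤ) - 1), lam k l * (Module.finrank ℂ (Hend n k l) : ℝ)

/-- The functional `(1 / N) ∑_{ℓ=1}^{k-1} λ_ℓ Tr_ℓ` on the image of `Φ`. -/
def weightedTrace (n k : ℕ) : (Phi n k).range →ₗ[ℂ] ℂ :=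
  ((1 / (normalization n k : ℂ)) •
    ∑ l ∈ Finset.Icc (1 : ℤ) ((k : ℤ) - 1), (lam k l : ℂ) • trEnd n k l) ∘ₗ
      (Phi n k).range.val.toLinearMap

end PathModel

end

/-! Uniqueness. Inside `TL (n + 1) d` let A be the algebra of words in E_1, …, E_{n-1}. The
relations reduce every word to a combination of words with at most one E_n, so the whole algebra is
A + A E_n A (`wordSpan_succ_le`). Let T be the difference of two Markov traces at level n + 1. If
they agree at level n, then T vanishes on A E_n, hence on A E_n A by cyclicity. A Markov trace is
not assumed compatible with the inclusions, so A needs its own argument: E_i = E_i E_{i+1} E_i and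
cyclicity raise the index of the last letter of a word until it is E_n, and T(1) = 0
(`trace_eq_zero_on_wordSpan`).

Existence. Let D be the diagonal operator with eigenvalue λ_ℓ on the paths ending at ℓ. Then ∑ λ_ℓ
Tr_ℓ(X) = Tr(XD) (`sum_trEnd`). Since Φ_i only mixes paths that differ by exchanging two adjacent
bits, it preserves endpoints. So D and the projections onto the H_{n,k,ℓ} commute with the image of
Φ (`Phi_mul_endOp`), which gives the invariance of the blocks and the trace property.

For the Markov property, take the partial trace over the last step (`trace_succ`). Because λ_{ℓ-1} +
λ_{ℓ+1} = d λ_ℓ and λ_0 = λ_k = 0, the partial trace of D is dD, so the normalization satisfies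
N_{n+1} = d N_n. The partial trace of DΦ_n is D itself. The ratio of the normalizations supplies the
factor 1/d. By uniqueness every Markov trace is this one. -/

noncomputable section

namespace PathModel

/-! ### Spanning the Temperley-Lieb algebra by words with at most one last generator -/

section Spanning

variable {A : Type} [Ring A] [Algebra ℂ A]

/-- The span of all products of the elements `e 0, …, e (j - 1)`. -/
def wordSpan (e : ℕ → A) (j : ℕ) : Submodule ℂ A :=
  Subalgebra.toSubmodule (Algebra.adjoin ℂ (e '' Set.Iio j))

theorem one_mem_wordSpan (e : ℕ → A) (j : ℕ) : 1 ∈ wordSpan e j :=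
  one_mem (Algebra.adjoin ℂ (e '' Set.Iio j))

theorem mem_wordSpan (e : ℕ → A) {i j : ℕ} (h : i < j) : e i ∈ wordSpan e j :=
  Algebra.subset_adjoin ⟨i, h, rfl⟩

theorem mul_mem_wordSpan {e : ℕ → A} {j : ℕ} {x y : A} (hx : x ∈ wordSpan e j)
    (hy : y ∈ wordSpan e j) : x * y ∈ wordSpan e j :=
  mul_mem (S := Subalgebra ℂ A) hx hy

theorem wordSpan_mul_self (e : ℕ → A) (j : ℕ) : wordSpan e j * wordSpan e j = wordSpan e j :=
  Subalgebra.isIdempotentElem_toSubmodule _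

theorem commute_of_mem_wordSpan {e : ℕ → A}
    (hcomm : ∀ i j, i + 2 ≤ j → e i * e j = e j * e i) {j : ℕ} {x : A}
    (hx : x ∈ wordSpan e j) : e (j + 1) * x = x * e (j + 1) := by
  have h : Algebra.adjoin ℂ (e '' Set.Iio j) ≤ Subalgebra.centralizer ℂ {e (j + 1)} := by
    refine Algebra.adjoin_le ?_
    rintro _ ⟨i, hi, rfl⟩
    have hi : i < j := hi
    rintro _ rfl
    exact (hcomm i (j + 1) (by omega)).symm
  exact Subalgebra.mem_centralizer_iff ℂ |>.1 (h hx) _ rfl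

theorem span_mul_span_self_le {x : A} {d : ℂ} (h : x * x = d • x) :
    Submodule.span ℂ {x} * Submodule.span ℂ {x} ≤ Submodule.span ℂ {x} := by
  rw [Submodule.span_mul_span, Set.singleton_mul_singleton, Submodule.span_singleton_le_iff_mem, h]
  exact Submodule.smul_mem _ _ (Submodule.mem_span_singleton_self x)

/-- With S the span of the lower words and T the line through `e j`, the hypothesis TST ≤ ST makes S
+ STS closed under products, and it contains 1 and all letters. The hypothesis is kept separate
because `sandwich_le` at `j + 1` needs this decomposition, which rests on `sandwich_le` at `j`. -/
theorem wordSpan_succ_le_of_sandwich {e : ℕ → A} {j : ℕ}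
    (h : Submodule.span ℂ {e j} * wordSpan e j * Submodule.span ℂ {e j} ≤
      wordSpan e j * Submodule.span ℂ {e j}) :
    wordSpan e (j + 1) ≤
      wordSpan e j + wordSpan e j * Submodule.span ℂ {e j} * wordSpan e j := by
  have hSS := wordSpan_mul_self e j
  have h1 := one_mem_wordSpan e j
  have hS : ∀ i < j, e i ∈ wordSpan e j := fun i hi => mem_wordSpan e hi
  set S := wordSpan e j
  set T := Submodule.span ℂ {e j}
  have hSS' (X : Submodule ℂ A) : S * (S * X) = S * X := by rw [← mul_assoc, hSS]
  have hle : (S + S * T * S) * (S + S * T * S) ≤ S + S * T * S := by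
    have h2 : S * (T * S * T) * S ≤ S * T * S := by
      calc S * (T * S * T) * S ≤ S * (S * T) * S := by gcongr
        _ = S * T * S := by rw [hSS']
    calc (S + S * T * S) * (S + S * T * S)
        = S + S * T * S + (S * T * S + S * (T * S * T) * S) := by
          simp only [add_mul, mul_add, mul_assoc, hSS, hSS']
      _ ≤ S + S * T * S := by
          simp only [Submodule.add_eq_sup] at *
          exact sup_le le_rfl (sup_le le_sup_right (h2.trans le_sup_right))
  let M : Subalgebra ℂ A := (S + S * T * S).toSubalgebra
    (Submodule.mem_sup_left h1)
    (fun x y hx hy => hle (Submodule.mul_mem_mul hx hy))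
  have hM : Algebra.adjoin ℂ (e '' Set.Iio (j + 1)) ≤ M := by
    refine Algebra.adjoin_le ?_
    rintro _ ⟨i, hi, rfl⟩
    rcases Nat.lt_succ_iff_lt_or_eq.1 hi with hi | rfl
    · exact Submodule.mem_sup_left (hS i hi)
    · have := Submodule.mul_mem_mul
        (Submodule.mul_mem_mul h1 (Submodule.mem_span_singleton_self (R := ℂ) (e i))) h1
      rw [one_mul, mul_one] at this
      exact Submodule.mem_sup_right this
  exact hM

variable {e : ℕ → A} {d : ℂ}

theorem sandwich_le (hcomm : ∀ i j, i + 2 ≤ j → e i * e j = e j * e i)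
    (hbraid : ∀ i, e (i + 1) * e i * e (i + 1) = e (i + 1)) (hsq : ∀ i, e i * e i = d • e i)
    (j : ℕ) :
    Submodule.span ℂ {e j} * wordSpan e j * Submodule.span ℂ {e j} ≤
      wordSpan e j * Submodule.span ℂ {e j} := by
  induction j with
  | zero =>
    have h0 : wordSpan e 0 = 1 := by simp [wordSpan, Submodule.one_eq_range, Algebra.toSubmodule_bot]
    rw [h0, mul_one, one_mul]
    exact span_mul_span_self_le (hsq 0)
  | succ j ih =>
    have hsucc := wordSpan_succ_le_of_sandwich ih
    have hSS := wordSpan_mul_self e j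
    have hTT := span_mul_span_self_le (hsq (j + 1))
    have hmono : wordSpan e j ≤ wordSpan e (j + 1) :=
      Algebra.adjoin_mono (Set.image_mono (Set.Iio_subset_Iio j.le_succ))
    have hTS : Submodule.span ℂ {e (j + 1)} * wordSpan e j =
        wordSpan e j * Submodule.span ℂ {e (j + 1)} := by
      ext x
      rw [Submodule.mem_span_singleton_mul, Submodule.mem_mul_span_singleton]
      constructor
      · rintro ⟨z, hz, rfl⟩; exact ⟨z, hz, (commute_of_mem_wordSpan hcomm hz).symm⟩
      · rintro ⟨z, hz, rfl⟩; exact ⟨z, hz, commute_of_mem_wordSpan hcomm hz⟩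
    have hTUT : Submodule.span ℂ {e (j + 1)} * Submodule.span ℂ {e j} *
        Submodule.span ℂ {e (j + 1)} = Submodule.span ℂ {e (j + 1)} := by
      simp only [Submodule.span_mul_span, Set.singleton_mul_singleton, hbraid]
    -- A stronger bound holds: the left factor can be taken in `wordSpan e j`, all of which commutes
    -- with `e (j + 1)`.
    refine le_trans ?_ (mul_le_mul_left hmono _)
    set S := wordSpan e j
    set T := Submodule.span ℂ {e (j + 1)}
    set U := Submodule.span ℂ {e j}
    calc T * wordSpan e (j + 1) * T ≤ T * (S + S * U * S) * T := by gcongr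
      _ = (T * S) * T + (T * S) * U * (S * T) := by simp only [add_mul, mul_add, mul_assoc]
      -- Moving S outwards brings the two copies of T next to each other or around U, where the
      -- relations collapse them to a single T.
      _ = S * (T * T) + S * (T * U * T) * S := by rw [hTS, ← hTS]; simp only [mul_assoc, hTS]
      _ ≤ S * T + S * T * S := by rw [hTUT]; gcongr
      _ = S * T := by
        rw [mul_assoc, hTS, ← mul_assoc, hSS, Submodule.add_eq_sup, sup_idem]

theorem wordSpan_succ_le (hcomm : ∀ i j, i + 2 ≤ j → e i * e j = e j * e i)
    (hbraid : ∀ i, e (i + 1) * e i * e (i + 1) = e (i + 1)) (hsq : ∀ i, e i * e i = d • e i)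
    (j : ℕ) :
    wordSpan e (j + 1) ≤
      wordSpan e j + wordSpan e j * Submodule.span ℂ {e j} * wordSpan e j :=
  wordSpan_succ_le_of_sandwich (sandwich_le hcomm hbraid hsq j)

/-- A functional vanishes on a span of words if it vanishes on `1` and on every word with a
last letter. -/
theorem eq_zero_on_wordSpan {T : A →ₗ[ℂ] ℂ} {j : ℕ} (h1 : T 1 = 0)
    (h : ∀ i < j, ∀ x ∈ wordSpan e j, T (x * e i) = 0) {x : A} (hx : x ∈ wordSpan e j) :
    T x = 0 := by
  rw [wordSpan, Algebra.adjoin_eq_span] at hx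
  induction hx using Submodule.span_induction with
  | mem x hx =>
    induction hx using Submonoid.closure_induction_right with
    | one => exact h1
    | mul_right x hx y hy _ =>
      obtain ⟨i, hi, rfl⟩ := hy
      refine h i hi x ?_
      rw [wordSpan, Algebra.adjoin_eq_span]
      exact Submodule.subset_span hx
  | zero => exact map_zero T
  | add x y _ _ hx hy => rw [map_add, hx, hy, add_zero]
  | smul c x _ hx => rw [map_smul, hx, smul_zero]

/-- A trace that vanishes on `1` and on the words whose only last generator is their last letter
vanishes. -/
theorem trace_eq_zero_on_wordSpan (hcomm : ∀ i j, i + 2 ≤ j → e i * e j = e j * e i)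
    (hbraid : ∀ i, e (i + 1) * e i * e (i + 1) = e (i + 1)) (hsq : ∀ i, e i * e i = d • e i)
    {T : A →ₗ[ℂ] ℂ} (hT : ∀ x y, T (x * y) = T (y * x)) (h1 : T 1 = 0) {m : ℕ}
    (hbraid' : ∀ i < m, e i * e (i + 1) * e i = e i)
    (hm : ∀ x ∈ wordSpan e m, T (x * e m) = 0) {x : A} (hx : x ∈ wordSpan e (m + 1)) :
    T x = 0 := by
  -- Descending induction on the last letter. With e_i = e_i e_{i+1} e_i, cyclicity turns T(x e_i)
  -- into T((e_i x e_i) e_{i+1}), and e_i x e_i is again in the span of the lower words.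
  have hlow : ∀ r ≤ m, ∀ x ∈ wordSpan e m, T (x * e (m - r)) = 0 := by
    intro r hr
    induction r with
    | zero => simpa using hm
    | succ r ih =>
      intro x hx
      obtain ⟨i, hi⟩ : ∃ i, i = m - (r + 1) := ⟨_, rfl⟩
      have hi' : m - r = i + 1 := by omega
      have him : i < m := by omega
      have hei := mem_wordSpan e him
      rw [← hi, ← hbraid' i him, show x * (e i * e (i + 1) * e i) = x * e i * e (i + 1) * e i by
        simp only [mul_assoc], hT, show e i * (x * e i * e (i + 1)) = e i * x * e i * e (i + 1) by
        simp only [mul_assoc], ← hi']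
      exact ih (by omega) _ (mul_mem_wordSpan (mul_mem_wordSpan hei hx) hei)
  have hS : ∀ x ∈ wordSpan e m, T x = 0 := fun x hx =>
    eq_zero_on_wordSpan h1 (fun i hi y hy => by
      have := hlow (m - i) (by omega) y hy
      rwa [Nat.sub_sub_self hi.le] at this) hx
  obtain ⟨a, ha, b, hb, rfl⟩ := Submodule.mem_sup.1 (wordSpan_succ_le hcomm hbraid hsq m hx)
  rw [map_add, hS a ha, zero_add]
  refine Submodule.mul_induction_on hb (fun u hu v hv => ?_) fun y z hy hz => by
    rw [map_add, hy, hz, add_zero]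
  obtain ⟨w, hw, rfl⟩ := Submodule.mem_mul_span_singleton.1 hu
  -- Cyclicity moves v in w e_m v to the front, leaving `e m` as the last letter.
  rw [hT, ← mul_assoc]
  exact hm _ (mul_mem_wordSpan hv hw)

end Spanning

/-! ### Uniqueness of the Markov trace -/

/-- The generators of `TL_n(d)`, continued by `0`. -/
def gen (n : ℕ) (d : ℂ) (i : ℕ) : TL n d := if h : i < n - 1 then TL.E n d ⟨i, h⟩ else 0

theorem gen_of_lt {n : ℕ} {d : ℂ} {i : ℕ} (h : i < n - 1) : gen n d i = TL.E n d ⟨i, h⟩ :=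
  dif_pos h

theorem gen_comm (n : ℕ) (d : ℂ) (i j : ℕ) (h : i + 2 ≤ j) :
    gen n d i * gen n d j = gen n d j * gen n d i := by
  unfold gen
  split_ifs with h1 h2
  · exact TL.E_comm _ _ _ _ (Or.inl h)
  all_goals simp

theorem gen_sq (n : ℕ) (d : ℂ) (i : ℕ) : gen n d i * gen n d i = d • gen n d i := by
  unfold gen
  split_ifs with h1
  · exact TL.E_sq _ _ _
  · simp

/-- In this order the relation survives the continuation by 0, since both sides vanish with `gen n d
(i + 1)`. The opposite order fails when only `i + 1` is out of range, so `gen_braid'` carries a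
bound. -/
theorem gen_braid (n : ℕ) (d : ℂ) (i : ℕ) :
    gen n d (i + 1) * gen n d i * gen n d (i + 1) = gen n d (i + 1) := by
  by_cases h : i + 1 < n - 1
  · rw [gen_of_lt h, gen_of_lt (show i < n - 1 by omega)]
    exact TL.E_braid _ _ _ _ (Or.inr rfl)
  · simp [gen, h]

theorem gen_braid' {n : ℕ} (d : ℂ) {i : ℕ} (h : i + 1 < n - 1) :
    gen n d i * gen n d (i + 1) * gen n d i = gen n d i := by
  rw [gen_of_lt h, gen_of_lt (show i < n - 1 by omega)]
  exact TL.E_braid _ _ _ _ (Or.inl rfl)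

/-! ### Words in the generators exhaust the Temperley-Lieb algebra -/

theorem TL.lift_E {n : ℕ} {d : ℂ} {A : Type} [Ring A] [Algebra ℂ A] (f : Fin (n - 1) → A)
    (hcomm hbraid hsq) (i : Fin (n - 1)) :
    TL.lift n d f hcomm hbraid hsq (TL.E n d i) = f i := by
  unfold TL.lift TL.E
  rw [RingQuot.liftAlgHom_mkAlgHom_apply, FreeAlgebra.lift_ι_apply]

theorem TL.incl_E (n : ℕ) (d : ℂ) (i : Fin (n - 1)) :
    TL.incl n d (TL.E n d i) = TL.E (n + 1) d ⟨i, by omega⟩ :=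
  TL.lift_E _ _ _ _ i

theorem TL.adjoin_range_E (n : ℕ) (d : ℂ) : Algebra.adjoin ℂ (Set.range (TL.E n d)) = ⊤ := by
  have h : Set.range (TL.E n d) =
      RingQuot.mkAlgHom ℂ (TLRel n d) '' Set.range (FreeAlgebra.ι ℂ) := by
    rw [← Set.range_comp]; rfl
  rw [h, ← AlgHom.map_adjoin, FreeAlgebra.adjoin_range_ι, Algebra.map_top,
    AlgHom.range_eq_top]
  exact RingQuot.mkAlgHom_surjective _ _

theorem TL.induction {n : ℕ} {d : ℂ} {p : TL n d → Prop} (hE : ∀ i, p (TL.E n d i))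
    (hc : ∀ c : ℂ, p (algebraMap ℂ _ c)) (hadd : ∀ x y, p x → p y → p (x + y))
    (hmul : ∀ x y, p x → p y → p (x * y)) (x : TL n d) : p x := by
  have hx : x ∈ Algebra.adjoin ℂ (Set.range (TL.E n d)) := by
    rw [TL.adjoin_range_E]; trivial
  induction hx using Algebra.adjoin_induction with
  | mem x hx => obtain ⟨i, rfl⟩ := hx; exact hE i
  | algebraMap c => exact hc c
  | add x y _ _ hx hy => exact hadd x y hx hy
  | mul x y _ _ hx hy => exact hmul x y hx hy

theorem wordSpan_gen (n : ℕ) (d : ℂ) : wordSpan (gen n d) (n - 1) = ⊤ := by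
  have h : gen n d '' Set.Iio (n - 1) = Set.range (TL.E n d) := by
    ext x
    constructor
    · rintro ⟨i, hi, rfl⟩
      exact ⟨⟨i, hi⟩, (gen_of_lt hi).symm⟩
    · rintro ⟨i, rfl⟩
      exact ⟨i, i.2, gen_of_lt i.2⟩
  rw [wordSpan, h, TL.adjoin_range_E, Algebra.top_toSubmodule]

theorem wordSpan_gen_le_range_incl (n : ℕ) (d : ℂ) {x : TL (n + 1) d}
    (hx : x ∈ wordSpan (gen (n + 1) d) (n - 1)) : ∃ y, TL.incl n d y = x := by
  have h : Algebra.adjoin ℂ (gen (n + 1) d '' Set.Iio (n - 1)) ≤ (TL.incl n d).range := by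
    refine Algebra.adjoin_le ?_
    rintro _ ⟨i, hi, rfl⟩
    have hi : i < n - 1 := hi
    refine ⟨TL.E n d ⟨i, hi⟩, ?_⟩
    rw [gen_of_lt (by omega)]
    exact TL.incl_E n d _
  exact h hx

theorem IsMarkovTrace.unique {d : ℂ} {Tr Tr' : (n : ℕ) → TL n d →ₗ[ℂ] ℂ}
    (h : IsMarkovTrace d Tr) (h' : IsMarkovTrace d Tr') {n : ℕ} (hn : 1 ≤ n) : Tr n = Tr' n := by
  induction n, hn using Nat.le_induction with
  | base =>
    rw [← sub_eq_zero]
    ext x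
    have hx : x ∈ wordSpan (gen 1 d) 0 := by
      rw [show 0 = 1 - 1 from rfl, wordSpan_gen]; trivial
    refine eq_zero_on_wordSpan ?_ (fun i hi => absurd hi i.not_lt_zero) hx
    simp [h.map_one, h'.map_one]
  | succ n hn ih =>
    rw [← sub_eq_zero]
    ext x
    -- The last generator E_n has index `n - 1`, which plays the role of `m` in
    -- `trace_eq_zero_on_wordSpan`.
    have hx : x ∈ wordSpan (gen (n + 1) d) (n - 1 + 1) := by
      rw [show n - 1 + 1 = n + 1 - 1 by omega, wordSpan_gen]; trivial
    refine trace_eq_zero_on_wordSpan (gen_comm _ _) (gen_braid _ _) (gen_sq _ _) ?_ ?_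
      (fun i hi => gen_braid' d (by omega)) ?_ hx
    · intro x y
      simp [h.map_mul_comm (n + 1) (by omega) x y, h'.map_mul_comm (n + 1) (by omega) x y]
    · simp [h.map_one, h'.map_one]
    · intro x hx
      obtain ⟨y, rfl⟩ := wordSpan_gen_le_range_incl n d hx
      rw [gen_of_lt (by omega), LinearMap.sub_apply, h.markov n hn, h'.markov n hn, ih, sub_self]

/-! ### The weight operator and the weighted trace -/

theorem hom_ext {n k : ℕ} {V : Type} [AddCommGroup V] [Module ℂ V] {f g : H n k →ₗ[ℂ] V}
    (h : ∀ s : Fin n → Bool, IsPath k s → f (ket k s) = g (ket k s)) : f = g := by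
  apply (EuclideanSpace.basisFun (Path n k) ℂ).toBasis.ext
  intro p
  have := h p.1 p.2
  rw [ket_of_isPath p.2] at this
  simpa using this

theorem constr_ket {n k : ℕ} {V : Type} [AddCommGroup V] [Module ℂ V] (f : Path n k → V)
    {s : Fin n → Bool} (h : IsPath k s) :
    (EuclideanSpace.basisFun (Path n k) ℂ).toBasis.constr ℂ f (ket k s) = f ⟨s, h⟩ := by
  have h2 : ket k s = (EuclideanSpace.basisFun (Path n k) ℂ).toBasis ⟨s, h⟩ := by
    rw [ket_of_isPath h]; simp
  rw [h2, Module.Basis.constr_basis]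

theorem inner_ket_of_ne {n k : ℕ} {s t : Fin n → Bool} (h : s ≠ t) :
    inner ℂ (ket k s) (ket k t) = 0 := by
  by_cases hs : IsPath k s
  · by_cases ht : IsPath k t
    · rw [ket_of_isPath hs, ket_of_isPath ht]
      rw [EuclideanSpace.inner_single_left, PiLp.single_apply, if_neg (by simpa using h),
        mul_zero]
    · simp [ket_of_not ht]
  · simp [ket_of_not hs]

/-- The diagonal operator that multiplies `|s⟩` by `f ℓ`, where `ℓ` is the end of `s`. -/
def endOp (n k : ℕ) (f : ℤ → ℂ) : Module.End ℂ (H n k) :=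
  (EuclideanSpace.basisFun (Path n k) ℂ).toBasis.constr ℂ
    (fun p => f (vertex p.1 n) • ket k p.1)

theorem endOp_ket {n k : ℕ} (f : ℤ → ℂ) (s : Fin n → Bool) :
    endOp n k f (ket k s) = f (vertex s n) • ket k s := by
  by_cases h : IsPath k s
  · exact constr_ket _ h
  · simp [ket_of_not h]

theorem Phi_E (n k : ℕ) (i : Fin (n - 1)) : Phi n k (TL.E n _ i) = phiOp n k i :=
  TL.lift_E _ _ _ _ i

/-- Exchanging two different adjacent bits moves only the vertex between them, so the endpoint, on
which `f` is evaluated, stays fixed. -/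
theorem phiOp_mul_endOp {n k : ℕ} (f : ℤ → ℂ) (i : Fin (n - 1)) :
    phiOp n k i * endOp n k f = endOp n k f * phiOp n k i := by
  apply end_ext
  intro s hs
  simp only [Module.End.mul_apply, endOp_ket, map_smul]
  have hi : (i : ℕ) + 1 < n := by omega
  obtain ⟨x, hx⟩ : ∃ x, s ⟨i, by omega⟩ = x := ⟨_, rfl⟩
  by_cases hy : s ⟨i + 1, hi⟩ = x
  · rw [phiOp_eq_zero i hx hy, map_zero, smul_zero]
  have hy : s ⟨i + 1, hi⟩ = !x := by revert hy; cases x <;> simp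
  rw [phiOp_ne i hx hy rfl rfl, map_add, map_smul, map_smul, endOp_ket, endOp_ket,
    vertex_setBits_ge s hi hx hy (by omega)]
  module

theorem Phi_mul_endOp {n k : ℕ} (f : ℤ → ℂ) (X : TL n (loopValue k)) :
    Phi n k X * endOp n k f = endOp n k f * Phi n k X := by
  induction X using TL.induction with
  | hE i => rw [Phi_E, phiOp_mul_endOp]
  | hc c => rw [AlgHom.commutes]; exact Algebra.commutes c _
  | hadd x y hx hy => rw [map_add, add_mul, mul_add, hx, hy]
  | hmul x y hx hy => rw [map_mul, mul_assoc, hy, ← mul_assoc, hx, mul_assoc]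

/-- Kets ending elsewhere are orthogonal to `Hend n k l`, so its projection is diagonal in the kets.
Blocks can then be handled by operators on the whole space. -/
theorem subtype_comp_orthogonalProjectionOnto (n k : ℕ) (l : ℤ) :
    (Hend n k l).subtype ∘ₗ (Hend n k l).orthogonalProjectionOnto.toLinearMap =
      endOp n k (Pi.single l 1) := by
  apply hom_ext
  intro s hs
  rw [endOp_ket]
  by_cases h : vertex s n = l
  · have hmem : ket k s ∈ Hend n k l := Submodule.subset_span ⟨s, ⟨hs, h⟩, rfl⟩
    subst h
    simpa using congrArg Subtype.val
      (Submodule.orthogonalProjectionOnto_mem_subspace_eq_self (⟨ket k s, hmem⟩ : Hend n k _))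
  · have hmem : ket k s ∈ (Hend n k l)ᗮ := by
      rw [Hend, Submodule.mem_orthogonal]
      intro u hu
      induction hu using Submodule.span_induction with
      | mem u hu =>
        obtain ⟨t, ⟨-, ht⟩, rfl⟩ := hu
        exact inner_ket_of_ne (by rintro rfl; exact h ht)
      | zero => simp
      | add u v _ _ hu hv => rw [inner_add_left, hu, hv, add_zero]
      | smul c u _ hu => rw [inner_smul_left, hu, mul_zero]
    have := Submodule.orthogonalProjectionOnto_eq_zero_iff.2 hmem
    simp [h, this]

/-- Cyclicity of the trace between the subspace and the whole space. -/
theorem trEnd_apply (n k : ℕ) (l : ℤ) (X : Module.End ℂ (H n k)) :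
    trEnd n k l X = LinearMap.trace ℂ (H n k) (X * endOp n k (Pi.single l 1)) := by
  rw [← subtype_comp_orthogonalProjectionOnto]
  exact LinearMap.trace_comp_comm' (X ∘ₗ (Hend n k l).subtype)
    (Hend n k l).orthogonalProjectionOnto.toLinearMap

theorem sum_endOp_single (n k : ℕ) :
    ∑ l ∈ Finset.Icc (1 : ℤ) ((k : ℤ) - 1), (lam k l : ℂ) • endOp n k (Pi.single l 1) =
      endOp n k (fun l => (lam k l : ℂ)) := by
  apply end_ext
  intro s hs
  simp only [LinearMap.sum_apply, LinearMap.smul_apply, endOp_ket, smul_smul, ← Finset.sum_smul]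
  congr 1
  have := Finset.mem_Icc.2 (hs n le_rfl)
  rw [Finset.sum_eq_single_of_mem _ this]
  · simp
  · intro l _ hl
    simp [hl.symm]

theorem sum_trEnd (n k : ℕ) (X : Module.End ℂ (H n k)) :
    ∑ l ∈ Finset.Icc (1 : ℤ) ((k : ℤ) - 1), (lam k l : ℂ) * trEnd n k l X =
      LinearMap.trace ℂ _ (X * endOp n k (fun l => (lam k l : ℂ))) := by
  simp only [trEnd_apply, ← sum_endOp_single, Finset.mul_sum, map_sum, mul_smul_comm, map_smul,
    smul_eq_mul]

theorem trEnd_one (n k : ℕ) (l : ℤ) : trEnd n k l 1 = Module.finrank ℂ (Hend n k l) := by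
  rw [← LinearMap.trace_one]
  change LinearMap.trace ℂ _ (block n k l 1) = _
  congr 1
  ext v
  simp [block]

theorem normalization_eq (n k : ℕ) : (normalization n k : ℂ) =
    LinearMap.trace ℂ _ (endOp n k (fun l => (lam k l : ℂ))) := by
  rw [← one_mul (endOp n k _), ← sum_trEnd, normalization]
  push_cast
  simp only [trEnd_one]

theorem weightedTrace_apply {n k : ℕ} (X : (Phi n k).range) : weightedTrace n k X =
    1 / (normalization n k : ℂ) *
      LinearMap.trace ℂ _ ((X : Module.End ℂ (H n k)) * endOp n k (fun l => (lam k l : ℂ))) := by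
  rw [← sum_trEnd]
  simp [weightedTrace]

theorem weightedTrace_mul_comm {n k : ℕ} (X Y : (Phi n k).range) :
    weightedTrace n k (X * Y) = weightedTrace n k (Y * X) := by
  obtain ⟨_, x, rfl⟩ := X
  obtain ⟨_, y, rfl⟩ := Y
  rw [weightedTrace_apply, weightedTrace_apply]
  congr 1
  simp only [MulMemClass.mk_mul_mk, AlgHom.toRingHom_eq_coe, RingHom.coe_coe]
  -- With D the weight operator: Tr(xyD) = Tr(xDy) = Tr(yxD).
  rw [mul_assoc, Phi_mul_endOp, ← mul_assoc, LinearMap.trace_mul_comm, ← mul_assoc]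

theorem endOp_single_apply_of_mem {n k : ℕ} {l : ℤ} {v : H n k} (hv : v ∈ Hend n k l) :
    endOp n k (Pi.single l 1) v = v := by
  rw [← subtype_comp_orthogonalProjectionOnto]
  exact congrArg Subtype.val
    (Submodule.orthogonalProjectionOnto_mem_subspace_eq_self (⟨v, hv⟩ : Hend n k l))

theorem apply_mem_Hend {n k : ℕ} {X : Module.End ℂ (H n k)} (hX : X ∈ (Phi n k).range) {l : ℤ}
    {v : H n k} (hv : v ∈ Hend n k l) : X v ∈ Hend n k l := by
  obtain ⟨x, rfl⟩ := hX
  have h := congrArg (· v) (Phi_mul_endOp (Pi.single l 1) x)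
  simp only [Module.End.mul_apply, endOp_single_apply_of_mem hv] at h
  rw [← subtype_comp_orthogonalProjectionOnto] at h
  change Phi n k x v ∈ _
  rw [h]
  exact Subtype.coe_prop _

/-! ### Adding and removing the last step -/

section LastStep

variable {n k : ℕ}

theorem vertex_snoc_of_le (s : Fin n → Bool) (b : Bool) {j : ℕ} (h : j ≤ n) :
    vertex (Fin.snoc s b : Fin (n + 1) → Bool) j = vertex s j := by
  induction j with
  | zero => rfl
  | succ j ih =>
    have hs : (Fin.snoc s b : Fin (n + 1) → Bool) ⟨j, by omega⟩ = s ⟨j, h⟩ :=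
      Fin.snoc_castSucc (α := fun _ => Bool) b s ⟨j, h⟩
    rw [vertex_succ _ (show j < n + 1 by omega), vertex_succ _ (show j < n by omega),
      ih (by omega), hs]

theorem vertex_snoc_last (s : Fin n → Bool) (b : Bool) :
    vertex (Fin.snoc s b : Fin (n + 1) → Bool) (n + 1) =
      vertex s n + if b then 1 else -1 := by
  have hs : (Fin.snoc s b : Fin (n + 1) → Bool) ⟨n, by omega⟩ = b :=
    Fin.snoc_last (α := fun _ => Bool) b s
  rw [vertex_succ _ (show n < n + 1 by omega), vertex_snoc_of_le _ _ le_rfl, hs]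

theorem isPath_snoc {s : Fin n → Bool} {b : Bool} :
    IsPath k (Fin.snoc s b : Fin (n + 1) → Bool) ↔ IsPath k s ∧
      1 ≤ vertex (Fin.snoc s b : Fin (n + 1) → Bool) (n + 1) ∧
        vertex (Fin.snoc s b : Fin (n + 1) → Bool) (n + 1) ≤ (k : ℤ) - 1 := by
  constructor
  · intro h
    refine ⟨fun j hj => ?_, h _ le_rfl⟩
    have := h j (by omega)
    rwa [vertex_snoc_of_le _ _ hj] at this
  · rintro ⟨h, h'⟩ j hj
    rcases Nat.le_succ_iff.1 hj with hj | rfl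
    · rw [vertex_snoc_of_le _ _ hj]; exact h j hj
    · exact h'

/-- A path can leave the graph in one step only to 0 or k, where the sine vanishes. This removes
boundary cases from the partial traces. -/
theorem lam_eq_zero_of_not_isPath_snoc {s : Fin n → Bool} {b : Bool} (hs : IsPath k s)
    (h : ¬ IsPath k (Fin.snoc s b : Fin (n + 1) → Bool)) :
    lam k (vertex (Fin.snoc s b : Fin (n + 1) → Bool) (n + 1)) = 0 := by
  rw [isPath_snoc, not_and, vertex_snoc_last] at h
  have h := h hs
  have hv := hs n le_rfl
  rw [vertex_snoc_last]
  have : (vertex s n + if b then 1 else -1) = 0 ∨ (vertex s n + if b then 1 else -1) = k := by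
    cases b <;> simp only [if_true, if_false, Bool.false_eq_true] at h ⊢ <;> omega
  rcases this with h | h <;> rw [h]
  · exact lam_zero k
  · exact lam_self k

/-- The operator `|s⟩ ↦ |s b⟩`. -/
def appendBit (n k : ℕ) (b : Bool) : H n k →ₗ[ℂ] H (n + 1) k :=
  (EuclideanSpace.basisFun (Path n k) ℂ).toBasis.constr ℂ
    (fun p => ket k (Fin.snoc p.1 b : Fin (n + 1) → Bool))

/-- The operator `|s b⟩ ↦ |s⟩` that kills the paths with another last bit. -/
def dropBit (n k : ℕ) (b : Bool) : H (n + 1) k →ₗ[ℂ] H n k :=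
  (EuclideanSpace.basisFun (Path (n + 1) k) ℂ).toBasis.constr ℂ
    (fun p => if p.1 (Fin.last n) = b then ket k (Fin.init p.1 : Fin n → Bool) else 0)

theorem appendBit_ket (b : Bool) (s : Fin n → Bool) :
    appendBit n k b (ket k s) = ket k (Fin.snoc s b : Fin (n + 1) → Bool) := by
  by_cases h : IsPath k s
  · exact constr_ket _ h
  · rw [ket_of_not h, map_zero, ket_of_not (fun h' => h (isPath_snoc.1 h').1)]

theorem dropBit_ket_of_ne {b : Bool} {s : Fin (n + 1) → Bool} (h : s (Fin.last n) ≠ b) :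
    dropBit n k b (ket k s) = 0 := by
  by_cases hs : IsPath k s
  · rw [dropBit, constr_ket _ hs, if_neg h]
  · rw [ket_of_not hs, map_zero]

theorem dropBit_ket_snoc {b : Bool} {s : Fin n → Bool}
    (h : IsPath k (Fin.snoc s b : Fin (n + 1) → Bool)) :
    dropBit n k b (ket k (Fin.snoc s b : Fin (n + 1) → Bool)) = ket k s := by
  rw [dropBit, constr_ket _ h]
  simp

theorem lam_smul_dropBit_ket_snoc (b : Bool) {s : Fin n → Bool} (hs : IsPath k s) :
    (lam k (vertex (Fin.snoc s b : Fin (n + 1) → Bool) (n + 1)) : ℂ) •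
        dropBit n k b (ket k (Fin.snoc s b : Fin (n + 1) → Bool)) =
      (lam k (vertex (Fin.snoc s b : Fin (n + 1) → Bool) (n + 1)) : ℂ) • ket k s := by
  by_cases h : IsPath k (Fin.snoc s b : Fin (n + 1) → Bool)
  · rw [dropBit_ket_snoc h]
  · simp [lam_eq_zero_of_not_isPath_snoc hs h]

theorem sum_appendBit_comp_dropBit (n k : ℕ) :
    ∑ b, appendBit n k b ∘ₗ dropBit n k b = LinearMap.id := by
  apply hom_ext
  intro s hs
  obtain ⟨t, b, rfl⟩ : ∃ (t : Fin n → Bool) (b : Bool), s = Fin.snoc t b :=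
    ⟨Fin.init s, s (Fin.last n), (Fin.snoc_init_self s).symm⟩
  rw [LinearMap.sum_apply, Finset.sum_eq_single b]
  · rw [LinearMap.comp_apply, dropBit_ket_snoc hs, appendBit_ket, LinearMap.id_apply]
  · intro c _ hc
    rw [LinearMap.comp_apply, dropBit_ket_of_ne (by simpa using hc.symm), map_zero]
  · simp

/-- The trace is computed through the partial trace over the last step: insert the resolution of the
identity by the last bit and use cyclicity. -/
theorem trace_succ (M : Module.End ℂ (H (n + 1) k)) :
    LinearMap.trace ℂ _ M =
      LinearMap.trace ℂ _ (∑ b, dropBit n k b ∘ₗ M ∘ₗ appendBit n k b) := by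
  conv_lhs => rw [← LinearMap.id_comp M, ← sum_appendBit_comp_dropBit,
    ← Module.End.mul_eq_comp, Finset.sum_mul]
  rw [map_sum, map_sum]
  refine Finset.sum_congr rfl fun b _ => ?_
  rw [Module.End.mul_eq_comp, LinearMap.comp_assoc, LinearMap.trace_comp_comm',
    LinearMap.comp_assoc]

theorem setBits_snoc (s : Fin n → Bool) (b x y : Bool) {i : ℕ} (h : i + 1 < n) :
    setBits (Fin.snoc s b : Fin (n + 1) → Bool) i x y = Fin.snoc (setBits s i x y) b := by
  funext t
  induction t using Fin.lastCases with
  | last => simp [setBits, show n ≠ i by omega, show n ≠ i + 1 by omega]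
  | cast t => simp [setBits]

/-! ### Partial traces over the last step -/

theorem phiOp_appendBit (b : Bool) (i : Fin (n - 1)) :
    phiOp (n + 1) k ⟨i, by omega⟩ ∘ₗ appendBit n k b = appendBit n k b ∘ₗ phiOp n k i := by
  apply hom_ext
  intro s hs
  simp only [LinearMap.comp_apply, appendBit_ket]
  have hi : (i : ℕ) + 1 < n := by omega
  have hsn (j : ℕ) (hj : j < n) :
      (Fin.snoc s b : Fin (n + 1) → Bool) ⟨j, by omega⟩ = s ⟨j, hj⟩ :=
    Fin.snoc_castSucc (α := fun _ => Bool) b s ⟨j, hj⟩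
  obtain ⟨x, hx⟩ : ∃ x, s ⟨i, by omega⟩ = x := ⟨_, rfl⟩
  by_cases hy : s ⟨i + 1, hi⟩ = x
  · rw [phiOp_eq_zero i hx hy, map_zero,
      phiOp_eq_zero _ ((hsn _ _).trans hx) ((hsn _ hi).trans hy)]
  have hy : s ⟨i + 1, hi⟩ = !x := by revert hy; cases x <;> simp
  rw [phiOp_ne i hx hy rfl rfl, phiOp_ne _ ((hsn _ _).trans hx) ((hsn _ hi).trans hy)
    (vertex_snoc_of_le _ _ (by simp; omega)) rfl, map_add, map_smul, map_smul, appendBit_ket,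
    appendBit_ket, setBits_snoc _ _ _ _ hi]

theorem Phi_incl_appendBit (b : Bool) (X : TL n (loopValue k)) :
    Phi (n + 1) k (TL.incl n _ X) ∘ₗ appendBit n k b = appendBit n k b ∘ₗ Phi n k X := by
  induction X using TL.induction with
  | hE i => rw [TL.incl_E, Phi_E, Phi_E, phiOp_appendBit]
  | hc c => ext v; simp [Algebra.algebraMap_eq_smul_one]
  | hadd x y hx hy =>
    rw [map_add, map_add, map_add, LinearMap.add_comp, LinearMap.comp_add, hx, hy]
  | hmul x y hx hy =>
    rw [map_mul, map_mul, map_mul, Module.End.mul_eq_comp, Module.End.mul_eq_comp,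
      LinearMap.comp_assoc, hy, ← LinearMap.comp_assoc, hx, LinearMap.comp_assoc]

/-- The two extensions of a path ending at ℓ have weights λ_{ℓ-1} and λ_{ℓ+1}, with sum d λ_ℓ; an
extension that is not a path has weight 0. -/
theorem sum_dropBit_weight_appendBit (n k : ℕ) :
    ∑ b, dropBit n k b ∘ₗ endOp (n + 1) k (fun l => (lam k l : ℂ)) ∘ₗ appendBit n k b =
      loopValue k • endOp n k (fun l => (lam k l : ℂ)) := by
  apply hom_ext
  intro s hs
  simp only [LinearMap.sum_apply, LinearMap.comp_apply, appendBit_ket, endOp_ket, map_smul,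
    LinearMap.smul_apply, lam_smul_dropBit_ket_snoc _ hs, ← Finset.sum_smul, smul_smul]
  congr 1
  have := lam_add k (vertex s n)
  simp only [vertex_snoc_last, Fintype.sum_bool, loopValue]
  norm_cast
  rw [← this, add_comm]
  simp [sub_eq_add_neg]

/-- If the last step of s goes from e to e + o, only the extension returning to e contributes. Its
diagonal coefficient λ_{e+o}/λ_e times its weight λ_e is the weight λ_{e+o} of s. -/
theorem sum_dropBit_weight_phiOp_appendBit (hn : 1 ≤ n) :
    ∑ b, dropBit n k b ∘ₗ (endOp (n + 1) k (fun l => (lam k l : ℂ)) *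
        phiOp (n + 1) k ⟨n - 1, by omega⟩) ∘ₗ appendBit n k b =
      endOp n k (fun l => (lam k l : ℂ)) := by
  apply hom_ext
  intro s hs
  obtain ⟨m, rfl⟩ : ∃ m, n = m + 1 := ⟨n - 1, by omega⟩
  simp only [Nat.add_sub_cancel]
  simp only [LinearMap.sum_apply, LinearMap.comp_apply, appendBit_ket, Module.End.mul_apply]
  obtain ⟨x, hx⟩ : ∃ x, s ⟨m, by omega⟩ = x := ⟨_, rfl⟩
  have hsx (b : Bool) : (Fin.snoc s b : Fin (m + 1 + 1) → Bool) ⟨m, by omega⟩ = x :=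
    (Fin.snoc_castSucc (α := fun _ => Bool) b s ⟨m, by omega⟩).trans hx
  have hsb (b : Bool) : (Fin.snoc s b : Fin (m + 1 + 1) → Bool) ⟨m + 1, by omega⟩ = b :=
    Fin.snoc_last (α := fun _ => Bool) b s
  obtain ⟨o, ho⟩ : ∃ o : ℤ, (if x then 1 else -1) = o := ⟨_, rfl⟩
  have ho' : (if !x then (1 : ℤ) else -1) = -o := by subst ho; cases x <;> simp
  obtain ⟨e, he⟩ : ∃ e, vertex s m = e := ⟨_, rfl⟩
  have hv : vertex s (m + 1) = e + o := by rw [vertex_succ_of (by omega) hx, he, ho]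
  have hv2 : vertex (Fin.snoc s (!x) : Fin (m + 1 + 1) → Bool) (m + 1 + 1) = e := by
    rw [vertex_snoc_last, hv, ho']; ring
  obtain ⟨he1, he2⟩ := hs m (by omega)
  rw [he] at he1 he2
  have hE := (lam_pos he1 he2).ne'
  have hpath : IsPath k (Fin.snoc s (!x) : Fin (m + 1 + 1) → Bool) :=
    isPath_snoc.2 ⟨hs, by rw [hv2]; exact ⟨he1, he2⟩⟩
  rw [Finset.sum_eq_single (!x)]
  -- The off-diagonal term has last bit `x`, so `dropBit` for `!x` kills it.
  · rw [phiOp_ne _ (hsx _) (hsb _) ((vertex_snoc_of_le s _ (by omega)).trans he) ho, map_add,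
      map_smul, map_smul, endOp_ket, endOp_ket, map_add, map_smul, map_smul, map_smul, map_smul,
      dropBit_ket_of_ne (s := setBits _ _ _ _), dropBit_ket_snoc hpath, endOp_ket, hv2, hv,
      smul_zero, smul_zero, add_zero, smul_smul]
    · congr 1
      norm_cast
      field_simp
    · rw [show Fin.last (m + 1) = ⟨m + 1, by omega⟩ from rfl, setBits_snd]
      simp
  · intro b _ hb
    have hb : b = x := by revert hb; cases b <;> cases x <;> simp
    rw [phiOp_eq_zero _ (hsx b) ((hsb b).trans hb), map_zero, map_zero]
  · simp

end LastStep

/-! ### The Markov property -/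

theorem normalization_succ (n k : ℕ) :
    (normalization (n + 1) k : ℂ) = loopValue k * normalization n k := by
  rw [normalization_eq, normalization_eq, trace_succ, sum_dropBit_weight_appendBit, map_smul,
    smul_eq_mul]

theorem trace_markov {n k : ℕ} (hn : 1 ≤ n) (X : TL n (loopValue k)) :
    LinearMap.trace ℂ _ (Phi (n + 1) k (TL.incl n _ X * TL.E (n + 1) _ ⟨n - 1, by omega⟩) *
        endOp (n + 1) k (fun l => (lam k l : ℂ))) =
      LinearMap.trace ℂ _ (Phi n k X * endOp n k (fun l => (lam k l : ℂ))) := by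
  -- The factor Φ(X) is cycled to the right end, where it passes through `appendBit` and leaves the
  -- partial trace of DΦ_n.
  rw [map_mul (Phi _ _), Phi_E, mul_assoc, LinearMap.trace_mul_comm, phiOp_mul_endOp, trace_succ,
    LinearMap.trace_mul_comm, ← sum_dropBit_weight_phiOp_appendBit hn]
  refine congrArg _ ?_
  rw [Finset.sum_mul]
  refine Finset.sum_congr rfl fun b _ => ?_
  rw [Module.End.mul_eq_comp, Module.End.mul_eq_comp, LinearMap.comp_assoc, LinearMap.comp_assoc,
    Phi_incl_appendBit]
  rfl

/-! ### Nonvanishing of the normalization, and the Markov trace -/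

theorem normalization_zero (k : ℕ) (hk : 3 ≤ k) : (normalization 0 k : ℂ) ≠ 0 := by
  have hpath (s : Fin 0 → Bool) : IsPath k s := by
    intro j hj
    obtain rfl : j = 0 := by omega
    simp only [vertex]
    omega
  have hD : endOp 0 k (fun l => (lam k l : ℂ)) = (lam k 1 : ℂ) • (1 : Module.End ℂ (H 0 k)) := by
    apply end_ext
    intro s _
    rw [endOp_ket]
    rfl
  have : Nonempty (Path 0 k) := ⟨⟨Fin.elim0, hpath _⟩⟩
  rw [normalization_eq, hD, map_smul, LinearMap.trace_one, finrank_euclideanSpace, smul_eq_mul]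
  refine mul_ne_zero ?_ (by exact_mod_cast Fintype.card_ne_zero)
  exact_mod_cast (lam_pos le_rfl (by omega)).ne'

theorem loopValue_ne_zero {k : ℕ} (hk : 3 ≤ k) : loopValue k ≠ 0 := by
  unfold loopValue
  have hk' : (3 : ℝ) ≤ k := by exact_mod_cast hk
  have hpi := Real.pi_pos
  -- Here k ≥ 3 enters: π/k lies strictly below π/2.
  have : 0 < Real.cos (Real.pi / k) := by
    apply Real.cos_pos_of_mem_Ioo
    have h0 : 0 < Real.pi / k := by positivity
    refine ⟨by linarith, ?_⟩
    apply div_lt_div_of_pos_left hpi <;> linarith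
  exact_mod_cast (mul_pos two_pos this).ne'

theorem normalization_ne_zero (n : ℕ) {k : ℕ} (hk : 3 ≤ k) : (normalization n k : ℂ) ≠ 0 := by
  induction n with
  | zero => exact normalization_zero k hk
  | succ n ih => rw [normalization_succ]; exact mul_ne_zero (loopValue_ne_zero hk) ih

theorem isMarkovTrace_weightedTrace {k : ℕ} (hk : 3 ≤ k) :
    IsMarkovTrace (loopValue k)
      (fun n => weightedTrace n k ∘ₗ (Phi n k).rangeRestrict.toLinearMap) where
  map_one n _ := by
    have h := normalization_ne_zero n hk
    simp only [LinearMap.comp_apply, AlgHom.toLinearMap_apply, weightedTrace_apply, map_one,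
      OneMemClass.coe_one, one_mul, ← normalization_eq]
    field_simp
  map_mul_comm n _ X Y := by
    simp only [LinearMap.comp_apply, AlgHom.toLinearMap_apply, map_mul]
    exact weightedTrace_mul_comm _ _
  markov n hn X := by
    have h := normalization_ne_zero n hk
    have hd := loopValue_ne_zero hk
    simp only [LinearMap.comp_apply, AlgHom.toLinearMap_apply, weightedTrace_apply,
      AlgHom.coe_codRestrict, AlgHom.rangeRestrict, trace_markov hn, normalization_succ]
    field_simp

end PathModel

end

theorem mainTheorem1 (k : ℕ) (hk : 3 ≤ k) :
    (∃ Tr : (n : ℕ) → PathModel.TL n (PathModel.loopValue k) →ₗ[ℂ] ℂ,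
      PathModel.IsMarkovTrace (PathModel.loopValue k) Tr) ∧
    ∀ n : ℕ, 1 ≤ n →
      (∀ X ∈ (PathModel.Phi n k).range, ∀ l ∈ Finset.Icc (1 : ℤ) ((k : ℤ) - 1),
        ∀ v ∈ PathModel.Hend n k l, X v ∈ PathModel.Hend n k l) ∧
      (∀ X Y : (PathModel.Phi n k).range,
        PathModel.weightedTrace n k (X * Y) = PathModel.weightedTrace n k (Y * X)) ∧
      (∀ Tr : (n : ℕ) → PathModel.TL n (PathModel.loopValue k) →ₗ[ℂ] ℂ,
        PathModel.IsMarkovTrace (PathModel.loopValue k) Tr →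
          Tr n = PathModel.weightedTrace n k ∘ₗ (PathModel.Phi n k).rangeRestrict.toLinearMap) :=
  ⟨⟨_, PathModel.isMarkovTrace_weightedTrace hk⟩, fun _ hn =>
    ⟨fun _ hX _ _ _ hv => PathModel.apply_mem_Hend hX hv, PathModel.weightedTrace_mul_comm,
      fun _ hTr => hTr.unique (PathModel.isMarkovTrace_weightedTrace hk) hn⟩⟩
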